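/- **Model.** A circuit with $n$ inputs and $k$ output bits is laid out on the planar grid of unit squares. Each node fills one square and has $s$ bits of memory. Each wire joins two nodes and runs along a path of adjacent squares that avoids all other nodes, and each side of a square is crossed by at most one wire. The area $A$ is the number of squares that contain a node or a part of a wire. The circuit runs for $T$ clock cycles. In each cycle, a node may receive one input symbol, sends one bit along each wire incident to it (depending on its memory, the cycle, and its current input symbol), receives one bit along each such wire, updates its memory, and may emit one output bit; the local functions are arbitrary. Each input symbol enters the circuit exactly once and each output bit is emitted once, at a node and a cycle fixed in advance, with at most one input symbol and at most one output bit per node and cycle. The energy is $E = AT$. The output nodes are the nodes that emit at least one output bit; the circuit is output regular if in every clock cycle in which some output node emits a bit, every output node does. **Decoding schemes.** Fix $\epsilon\in(0,1)$ and $s\in\mathbb N$. A decoding scheme is a sequence, indexed by block lengths $n_1<n_2<\cdots$, of encoding functions $\{0,1\}^{k(n)}\to\{0,1\}^{n}$ and circuits with $s$ bits of memory per node, each of which computes a decoding function $\{0,1,?\}^{n}\to\{0,1\}^{k(n)}$. Its block error probability $P_e(n)$ is the probability that the output of the circuit differs from the source, when the source consists of $k(n)$ independent fair bits and its codeword is sent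 over $n$ uses of the binary erasure channel with erasure probability $\epsilon$. For a function $f:\mathbb N\to\mathbb R$ with $f(n)\le 1$ for all sufficiently large $n$, an $f(n)$-decoding scheme is a decoding scheme with $P_e(n)<f(n)$ for all sufficiently large block lengths $n$ of the scheme. **Theorem.** Consider any $f(n)$-decoding scheme whose asymptotic rate $R=\lim k(n)/n$ exists and is positive, all of whose circuits are output regular, and whose number of output nodes increases without bound with $n$. Then its energy satisfies $E(n)=\Omega\bigl(n\,(-\ln f(n))^{1/5}\bigr)$, that is, there is a constant $c>0$ (which may depend on the scheme) such that, for all sufficiently large block lengths $n$ of the scheme, $$A(n)\,T(n)\ \ge\ c\,n\,\bigl(-\ln f(n)\bigr)^{1/5}.$$ -/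

import Mathlib

open Filter Topology

namespace VLSI

/-- The planar grid of unit squares: two squares are adjacent when they share a side. -/
noncomputable abbrev grid : SimpleGraph (ℤ × ℤ) :=
  SimpleGraph.boxProd (SimpleGraph.hasse ℤ) (SimpleGraph.hasse ℤ)

/-- The alphabet of the output of a binary erasure channel: a bit, or an erasure (`none`). -/
abbrev Symbol : Type := Option Bool

/-- A circuit in the Thompson model, with `n` inputs (channel output symbols) and `k` output bits,
in which every node has `s` bits of memory.

Layout. The circuit is laid out on the planar grid of unit squares. A node fills one square.
A wire joins two nodes and runs through a path of adjacent squares, avoiding the squares of all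
other nodes; wires have unit width, so each side of a square is crossed by at most one wire
(two wires can thus meet in a square, and cross there, but they cannot run side by side in it).

Operation. The circuit runs for `cycles` clock cycles, numbered `0, …, cycles - 1`. In each clock
cycle a node may receive one input symbol, it sends one bit along each wire that ends at it, receives
one bit along each such wire, updates its memory, and may produce one output bit. The local functions
of the nodes are arbitrary. Each input symbol enters the circuit exactly once and each output bit is
produced once, at nodes and clock cycles that are fixed in advance. -/
structure Circuit (s n k : ℕ) where
  /-- The squares filled by nodes. -/
  nodes : Finset (ℤ × ℤ)
  numWires : ℕ
  /-- The two end nodes of a wire. -/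
  tail : Fin numWires → nodes
  head : Fin numWires → nodes
  tail_ne_head : ∀ w, tail w ≠ head w
  /-- The route of a wire. -/
  route : ∀ w, grid.Walk (tail w : ℤ × ℤ) (head w : ℤ × ℤ)
  route_isPath : ∀ w, (route w).IsPath
  route_avoids : ∀ w x, x ∈ (route w).support → x ∈ nodes → x = tail w ∨ x = head w
  route_disjoint : ∀ w w', w ≠ w' → List.Disjoint (route w).edges (route w').edges
  /-- The number of clock cycles. -/
  cycles : ℕ
  /-- The initial contents of the memories. -/
  init : nodes → (Fin s → Bool)
  /-- The bit that a node sends along a wire in a given clock cycle, as a function of its memory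
  and of the input symbol (if any) that it receives in that cycle. -/
  send : nodes → ℕ → (Fin s → Bool) → Option Symbol → Fin numWires → Bool
  /-- The new contents of the memory of a node at the end of a given clock cycle, as a function of
  the old contents, of the input symbol (if any) and of the bits received along the wires. -/
  update : ∀ v : nodes, ℕ → (Fin s → Bool) → Option Symbol →
    ({w : Fin numWires // tail w = v ∨ head w = v} → Bool) → (Fin s → Bool)
  /-- The output bit of a node in a given clock cycle. -/
  emit : ∀ v : nodes, ℕ → (Fin s → Bool) → Option Symbol →
    ({w : Fin numWires // tail w = v ∨ head w = v} → Bool) → Bool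
  /-- The index of the input (if any) that a node receives in a given clock cycle. -/
  inputAt : nodes → ℕ → Option (Fin n)
  inputAt_lt : ∀ v t i, inputAt v t = some i → t < cycles
  inputAt_once : ∀ i, ∃! p : nodes × ℕ, inputAt p.1 p.2 = some i
  /-- The node and the clock cycle at which an output bit is produced. -/
  outputAt : Fin k → nodes × ℕ
  outputAt_lt : ∀ i, (outputAt i).2 < cycles
  outputAt_injective : Function.Injective outputAt

namespace Circuit

variable {s n k : ℕ} (C : Circuit s n k)

/-- The circuit area: the number of unit squares that hold a node or a part of a wire. -/
noncomputable def area : ℕ :=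
  (C.nodes ∪ Finset.univ.biUnion fun w => (C.route w).support.toFinset).card

/-- The energy of the computation, the product of the area and the number of clock cycles. -/
noncomputable def energy : ℕ := C.area * C.cycles

/-- The input symbol (if any) that node `v` receives in clock cycle `t`, on input `y`. -/
def inputSymbol (y : Fin n → Symbol) (t : ℕ) (v : C.nodes) : Option Symbol :=
  (C.inputAt v t).map y

/-- The node at the other end of a wire `w` that ends at `v`. -/
def farEnd (v : C.nodes) (w : Fin C.numWires) : C.nodes :=
  if C.tail w = v then C.head w else C.tail w

/-- The bits that node `v` receives in clock cycle `t` when the memories hold `m`. -/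
def received (y : Fin n → Symbol) (t : ℕ) (m : C.nodes → Fin s → Bool) (v : C.nodes)
    (w : {w : Fin C.numWires // C.tail w = v ∨ C.head w = v}) : Bool :=
  C.send (C.farEnd v w) t (m (C.farEnd v w)) (C.inputSymbol y t (C.farEnd v w)) w

/-- The contents of the memories at the beginning of clock cycle `t`, on input `y`. -/
def memory (y : Fin n → Symbol) : ℕ → C.nodes → Fin s → Bool
  | 0 => C.init
  | t + 1 => fun v => C.update v t (memory y t v) (C.inputSymbol y t v)
      (C.received y t (memory y t) v)

/-- The function computed by the circuit. -/
def decode (y : Fin n → Symbol) (i : Fin k) : Bool :=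
  let v := (C.outputAt i).1
  let t := (C.outputAt i).2
  C.emit v t (C.memory y t v) (C.inputSymbol y t v) (C.received y t (C.memory y t) v)

/-- The output nodes of the circuit. -/
def outputNodes : Finset C.nodes := Finset.univ.image fun i => (C.outputAt i).1

/-- In every clock cycle in which some output node produces a bit, all of them do. -/
def OutputRegular : Prop :=
  ∀ v ∈ C.outputNodes, ∀ i, ∃ i', C.outputAt i' = (v, (C.outputAt i).2)

end Circuit

/-- The transition probabilities of the binary erasure channel with erasure probability `ε`. -/
def bec (ε : ℝ) (x : Bool) (y : Symbol) : ℝ :=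
  if y = none then ε else if y = some x then 1 - ε else 0

/-- The block error probability of a decoding circuit for the code with encoding function `enc`:
the source is `k` independent fair bits, and the codeword is sent over `n` uses of the binary
erasure channel. -/
noncomputable def blockErrorProb {s n k : ℕ} (ε : ℝ) (enc : (Fin k → Bool) → (Fin n → Bool))
    (C : Circuit s n k) : ℝ :=
  ∑ x : Fin k → Bool, (1 / 2 : ℝ) ^ k *
    ∑ y : Fin n → Symbol, if C.decode y = x then 0 else ∏ i, bec ε (enc x i) (y i)

/-- A decoding scheme: a sequence of codes of increasing block length with decoding circuits.
All nodes of all the circuits have `s` bits of memory. -/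
structure DecodingScheme (s : ℕ) where
  /-- The block lengths. -/
  n : ℕ → ℕ
  n_strictMono : StrictMono n
  /-- The numbers of bits decoded. -/
  k : ℕ → ℕ
  /-- The encoding functions of the codes. -/
  enc : ∀ i, (Fin (k i) → Bool) → (Fin (n i) → Bool)
  circuit : ∀ i, Circuit s (n i) (k i)

namespace DecodingScheme

variable {s : ℕ} (D : DecodingScheme s)

/-- `R` is the asymptotic rate of the scheme. -/
def HasRate (R : ℝ) : Prop :=
  Tendsto (fun i => (D.k i : ℝ) / (D.n i : ℝ)) atTop (𝓝 R)

/-- The scheme is an `f(n)`-decoding scheme for the binary erasure channel with erasure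
probability `ε`. -/
def IsErrorScheme (ε : ℝ) (f : ℕ → ℝ) : Prop :=
  ∀ᶠ i in atTop, blockErrorProb ε (D.enc i) (D.circuit i) < f (D.n i)

def OutputRegular : Prop := ∀ i, (D.circuit i).OutputRegular

/-- The number of output nodes increases (without bound) with the block length. -/
def IncreasingOutputNodes : Prop :=
  Tendsto (fun i => (D.circuit i).outputNodes.card) atTop atTop

end DecodingScheme

end VLSI

/-! Cut space-time into pieces, each a `d × d` box of the grid during `d` cycles. What a piece emits
depends only on its own input symbols, its memory contents at the start, and the bits arriving along
wires that cross its border. If it emits more bits than enter this way, erasing its inputs leaves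
the emitted bits with too few possible values, so at least half of the sources are decoded wrongly.
Having `m` inputs, such a piece forces an error probability of at least `ε ^ m / 2`
(`blockErrorProb_ge_of_piece`). So each such piece has at least `l`, of order `-log f`, inputs.

The pieces partition inputs and outputs. At most `n / l` pieces emit more than they take in, each at
most `d ^ 3` bits; the others emit no more than the total boundary traffic, which is at most `(s +
4) * energy / d` once the tiling offset is chosen by averaging. Hence `k ≤ (s + 4) * energy / d + d
^ 3 / l * n` (`outputs_le_of_box`). As `k` is of order `n`, taking `d` to be a large multiple of
`energy / n` makes the first term at most half of the lower bound on `k`, and the second gives `l =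
O((energy / n) ^ 3)` (`neg_log_le_cube`). -/

namespace VLSI

/-! ### Erasures and the error probability -/

lemma bec_nonneg {ε : ℝ} (h0 : 0 ≤ ε) (h1 : ε ≤ 1) (x : Bool) (y : Symbol) : 0 ≤ bec ε x y := by
  unfold bec
  split_ifs <;> linarith

lemma sum_bec (ε : ℝ) (x : Bool) : ∑ y : Symbol, bec ε x y = 1 := by
  cases x <;> simp [bec, Fintype.sum_option]

/-- The probability that all the symbols in `J` are erased. -/
lemma sum_prod_bec_erased {n : ℕ} (ε : ℝ) (x : Fin n → Bool) (J : Finset (Fin n)) :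
    ∑ y : Fin n → Symbol with ∀ i ∈ J, y i = none, ∏ i, bec ε (x i) (y i) = ε ^ J.card := by
  -- The event is a product set, so the sum over it factors over the coordinates.
  have hE : (Finset.univ.filter fun y : Fin n → Symbol => ∀ i ∈ J, y i = none) =
      Fintype.piFinset fun i => if i ∈ J then {none} else Finset.univ := by
    ext y
    simp only [Finset.mem_filter, Finset.mem_univ, true_and, Fintype.mem_piFinset]
    refine forall_congr' fun i => ?_
    by_cases hi : i ∈ J <;> simp [hi]
  rw [hE, ← Finset.prod_univ_sum]
  have hfac : ∀ i, ∑ j ∈ (if i ∈ J then {none} else Finset.univ : Finset Symbol), bec ε (x i) j =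
      if i ∈ J then ε else 1 := by
    intro i
    by_cases hi : i ∈ J
    · simp [hi, bec]
    · simp only [hi, if_false, sum_bec]
  simp [hfac, Finset.prod_ite_mem]

/-- Sources that agree on `O` with an output in a set described by `U.card` bits are at most half
of all sources when `U.card < O.card`. -/
lemma two_mul_card_le_of_determined {k : ℕ} {Y ι : Type*} (E : Set Y) (U : Finset ι)
    (tr : Y → U → Bool) (dec : Y → Fin k → Bool) (O : Finset (Fin k)) (hUO : U.card < O.card)
    (hdet : ∀ y ∈ E, ∀ y' ∈ E, tr y = tr y' → ∀ i ∈ O, dec y i = dec y' i)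
    [DecidablePred fun x : Fin k → Bool => ∃ y ∈ E, ∀ i ∈ O, dec y i = x i] :
    2 * (Finset.univ.filter fun x : Fin k → Bool => ∃ y ∈ E, ∀ i ∈ O, dec y i = x i).card
      ≤ 2 ^ k := by
  classical
  have hOk : O.card ≤ k := by simpa using O.card_le_univ
  rw [← Fintype.card_subtype]
  have hchoice : ∀ x : {x : Fin k → Bool // ∃ y ∈ E, ∀ i ∈ O, dec y i = x i},
      ∃ y ∈ E, ∀ i ∈ O, dec y i = x.1 i := fun x => x.2
  choose y hyE hy using hchoice
  -- The bits of `x` on `O` can be recovered from the trace of its witness, so the trace and the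
  -- bits off `O` encode `x`.
  have hinj : Function.Injective
      fun x : {x : Fin k → Bool // ∃ y ∈ E, ∀ i ∈ O, dec y i = x i} =>
        (tr (y x), fun i : {i // i ∉ O} => x.1 i) := by
    intro x x' h
    obtain ⟨h1, h2⟩ := Prod.mk.inj h
    ext i
    by_cases hi : i ∈ O
    · rw [← hy x i hi, ← hy x' i hi, hdet _ (hyE x) _ (hyE x') h1 i hi]
    · exact congrFun h2 ⟨i, hi⟩
  have hcard := Fintype.card_le_of_injective _ hinj
  have hcompl : Fintype.card {i // i ∉ O} = k - O.card := by
    simp [Fintype.card_subtype_compl]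
  rw [Fintype.card_prod, Fintype.card_fun, Fintype.card_fun, Fintype.card_coe, hcompl,
    Fintype.card_bool, ← pow_add] at hcard
  calc _ ≤ 2 * 2 ^ (U.card + (k - O.card)) := Nat.mul_le_mul_left _ hcard
    _ = 2 ^ (U.card + (k - O.card) + 1) := by ring
    _ ≤ 2 ^ k := Nat.pow_le_pow_right (by norm_num) (by omega)

lemma blockErrorProb_nonneg {s n k : ℕ} {ε : ℝ} (h0 : 0 ≤ ε) (h1 : ε ≤ 1)
    (enc : (Fin k → Bool) → (Fin n → Bool)) (C : Circuit s n k) : 0 ≤ blockErrorProb ε enc C := by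
  refine Finset.sum_nonneg fun x _ => mul_nonneg (by positivity) (Finset.sum_nonneg fun y _ => ?_)
  split_ifs
  · exact le_rfl
  · exact Finset.prod_nonneg fun i _ => bec_nonneg h0 h1 _ _

/-- If, when the symbols in `J` are erased, the output bits in `O` are determined by fewer than
`O.card` bits, then a decoding error has probability at least `ε ^ J.card / 2`. -/
lemma blockErrorProb_ge_of_determined {s n k : ℕ} {ε : ℝ} (h0 : 0 ≤ ε) (h1 : ε ≤ 1)
    (enc : (Fin k → Bool) → (Fin n → Bool)) (C : Circuit s n k) {ι : Type*}
    (J : Finset (Fin n)) (O : Finset (Fin k)) (U : Finset ι) (hUO : U.card < O.card)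
    (tr : (Fin n → Symbol) → U → Bool)
    (hdet : ∀ y y' : Fin n → Symbol, (∀ i ∈ J, y i = none) → (∀ i ∈ J, y' i = none) →
      tr y = tr y' → ∀ i ∈ O, C.decode y i = C.decode y' i) :
    ε ^ J.card / 2 ≤ blockErrorProb ε enc C := by
  classical
  set E : Set (Fin n → Symbol) := {y | ∀ i ∈ J, y i = none} with hE
  have hgood := two_mul_card_le_of_determined E U tr C.decode O hUO
    (fun y hy y' hy' => hdet y y' hy hy')
  have hsplit := Finset.card_filter_add_card_filter_not (s := Finset.univ)
    (fun x : Fin k → Bool => ∃ y ∈ E, ∀ i ∈ O, C.decode y i = x i)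
  rw [Finset.card_univ, Fintype.card_fun, Fintype.card_bool, Fintype.card_fin] at hsplit
  set B := Finset.univ.filter fun x : Fin k → Bool => ¬∃ y ∈ E, ∀ i ∈ O, C.decode y i = x i
    with hB
  have hBcard : (2 : ℝ) ^ k ≤ 2 * B.card := by
    have : 2 ^ k ≤ 2 * B.card := by omega
    exact_mod_cast this
  -- For a source in `B`, every channel output with `J` erased is decoded wrongly, whatever the
  -- codeword.
  have hterm : ∀ x ∈ B, ε ^ J.card ≤
      ∑ y : Fin n → Symbol, if C.decode y = x then 0 else ∏ i, bec ε (enc x i) (y i) := by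
    intro x hx
    rw [← sum_prod_bec_erased ε (enc x) J, Finset.sum_filter]
    refine Finset.sum_le_sum fun y _ => ?_
    have hnn := Finset.prod_nonneg fun (i : Fin n) (_ : i ∈ Finset.univ) =>
      bec_nonneg h0 h1 (enc x i) (y i)
    by_cases hy : ∀ i ∈ J, y i = none
    · have hne : C.decode y ≠ x := by
        rintro rfl
        exact (Finset.mem_filter.1 hx).2 ⟨y, hy, fun _ _ => rfl⟩
      rw [if_pos hy, if_neg hne]
    · rw [if_neg hy]
      split_ifs
      · exact le_rfl
      · exact hnn
  calc ε ^ J.card / 2 = (1 / 2 : ℝ) ^ k * 2 ^ k / 2 * ε ^ J.card := by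
        rw [← mul_pow]; norm_num; ring
    _ ≤ (1 / 2 : ℝ) ^ k * (2 * B.card) / 2 * ε ^ J.card := by gcongr
    _ = ∑ x ∈ B, (1 / 2 : ℝ) ^ k * ε ^ J.card := by
        rw [Finset.sum_const, nsmul_eq_mul]; ring
    _ ≤ ∑ x ∈ B, (1 / 2 : ℝ) ^ k *
          ∑ y : Fin n → Symbol, if C.decode y = x then 0 else ∏ i, bec ε (enc x i) (y i) :=
        Finset.sum_le_sum fun x hx => mul_le_mul_of_nonneg_left (hterm x hx) (by positivity)
    _ ≤ blockErrorProb ε enc C := by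
        refine Finset.sum_le_sum_of_subset_of_nonneg (Finset.subset_univ _) fun x _ _ =>
          mul_nonneg (by positivity) (Finset.sum_nonneg fun y _ => ?_)
        split_ifs
        · exact le_rfl
        · exact Finset.prod_nonneg fun i _ => bec_nonneg h0 h1 _ _

/-! ### Information flow into a piece of space-time -/

namespace Circuit

variable {s n k : ℕ} (C : Circuit s n k)

open Classical in
/-- The inputs that enter at a node of `S` in a clock cycle of `[t₀, t₁)`. -/
noncomputable def inputsIn (S : Finset C.nodes) (t₀ t₁ : ℕ) : Finset (Fin n) :=
  Finset.univ.filter fun i => ∃ v ∈ S, ∃ t ∈ Finset.Ico t₀ t₁, C.inputAt v t = some i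

/-- The outputs produced at a node of `S` in a clock cycle of `[t₀, t₁)`. -/
def outputsIn (S : Finset C.nodes) (t₀ t₁ : ℕ) : Finset (Fin k) :=
  Finset.univ.filter fun i => (C.outputAt i).1 ∈ S ∧ (C.outputAt i).2 ∈ Finset.Ico t₀ t₁

/-- The wires with exactly one end in `S`. -/
def cutWires (S : Finset C.nodes) : Finset (Fin C.numWires) :=
  Finset.univ.filter fun w => ¬(C.tail w ∈ S ↔ C.head w ∈ S)

/-- The end outside `S` of a wire in `C.cutWires S`. -/
def outerEnd (S : Finset C.nodes) (w : Fin C.numWires) : C.nodes :=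
  if C.tail w ∈ S then C.head w else C.tail w

/-- The bits that enter the piece `S × [t₀, t₁)` of space-time: the initial memory contents
(constant if `t₀ = 0`) and the bits that arrive along the cut wires. -/
def boundaryBits (S : Finset C.nodes) (t₀ t₁ : ℕ) :
    Finset ((C.nodes × Fin s) ⊕ (Fin C.numWires × ℕ)) :=
  (if t₀ = 0 then ∅ else S ×ˢ Finset.univ).disjSum (C.cutWires S ×ˢ Finset.Ico t₀ t₁)

/-- The value of a bit on the boundary of a piece that begins in cycle `t₀`. -/
def boundaryValue (S : Finset C.nodes) (t₀ : ℕ) (y : Fin n → Symbol) :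
    (C.nodes × Fin s) ⊕ (Fin C.numWires × ℕ) → Bool
  | .inl (v, j) => C.memory y t₀ v j
  | .inr (w, t) => C.send (C.outerEnd S w) t (C.memory y t (C.outerEnd S w))
      (C.inputSymbol y t (C.outerEnd S w)) w

variable {C} {S : Finset C.nodes} {t₀ t₁ : ℕ} {y y' : Fin n → Symbol}

lemma inputSymbol_eq (hy : ∀ i ∈ C.inputsIn S t₀ t₁, y i = none)
    (hy' : ∀ i ∈ C.inputsIn S t₀ t₁, y' i = none) {t : ℕ} (ht : t ∈ Finset.Ico t₀ t₁)
    {v : C.nodes} (hv : v ∈ S) : C.inputSymbol y t v = C.inputSymbol y' t v := by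
  unfold inputSymbol
  rcases h : C.inputAt v t with _ | i
  · rfl
  · have hi : i ∈ C.inputsIn S t₀ t₁ := by
      simp only [inputsIn, Finset.mem_filter, Finset.mem_univ, true_and]
      exact ⟨v, hv, t, ht, h⟩
    simp [hy i hi, hy' i hi]

/-- A wire at a node of `S` comes either from another node of `S`, whose state is the same on both
inputs by `hm`, or from outside, and then its bit is one of the boundary bits. -/
lemma received_eq (hy : ∀ i ∈ C.inputsIn S t₀ t₁, y i = none)
    (hy' : ∀ i ∈ C.inputsIn S t₀ t₁, y' i = none)
    (hval : ∀ b ∈ C.boundaryBits S t₀ t₁, C.boundaryValue S t₀ y b = C.boundaryValue S t₀ y' b)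
    {t : ℕ} (ht : t ∈ Finset.Ico t₀ t₁) (hm : ∀ v ∈ S, C.memory y t v = C.memory y' t v)
    {v : C.nodes} (hv : v ∈ S) :
    C.received y t (C.memory y t) v = C.received y' t (C.memory y' t) v := by
  funext w
  unfold received
  by_cases hf : C.farEnd v w ∈ S
  · rw [hm _ hf, inputSymbol_eq hy hy' ht hf]
  · have hend : C.farEnd v w = C.outerEnd S w ∧ w.1 ∈ C.cutWires S := by
      obtain ⟨w, hw⟩ := w
      simp only [farEnd, outerEnd, cutWires, Finset.mem_filter, Finset.mem_univ, true_and] at hf ⊢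
      rcases hw with hw | hw
      · rw [if_pos hw] at hf
        simp [hw, hv, hf]
      · have hne : C.tail w ≠ v := fun h => C.tail_ne_head w (h.trans hw.symm)
        rw [if_neg hne] at hf
        simp [hne, hw, hv, hf]
    have := hval (.inr (w.1, t)) (by
      simp only [boundaryBits, Finset.inr_mem_disjSum, Finset.mem_product]
      exact ⟨hend.2, ht⟩)
    rw [hend.1]
    exact this

lemma memory_eq (hy : ∀ i ∈ C.inputsIn S t₀ t₁, y i = none)
    (hy' : ∀ i ∈ C.inputsIn S t₀ t₁, y' i = none)
    (hval : ∀ b ∈ C.boundaryBits S t₀ t₁, C.boundaryValue S t₀ y b = C.boundaryValue S t₀ y' b)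
    {t : ℕ} (h₀ : t₀ ≤ t) (h₁ : t ≤ t₁) : ∀ v ∈ S, C.memory y t v = C.memory y' t v := by
  induction t, h₀ using Nat.le_induction with
  | base =>
    intro v hv
    -- At time `0` the memories hold `init` on every input, so no boundary bits are needed for them.
    by_cases h0 : t₀ = 0
    · subst h0; rfl
    · funext j
      refine hval (.inl (v, j)) ?_
      simp [boundaryBits, h0, hv]
  | succ t ht ih =>
    intro v hv
    have htm : t ∈ Finset.Ico t₀ t₁ := Finset.mem_Ico.2 ⟨ht, h₁⟩
    have ih' := ih (Nat.le_of_succ_le h₁)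
    simp only [memory]
    rw [ih' v hv, inputSymbol_eq hy hy' htm hv, received_eq hy hy' hval htm ih' hv]

lemma decode_eq (hy : ∀ i ∈ C.inputsIn S t₀ t₁, y i = none)
    (hy' : ∀ i ∈ C.inputsIn S t₀ t₁, y' i = none)
    (hval : ∀ b ∈ C.boundaryBits S t₀ t₁, C.boundaryValue S t₀ y b = C.boundaryValue S t₀ y' b)
    {i : Fin k} (hi : i ∈ C.outputsIn S t₀ t₁) : C.decode y i = C.decode y' i := by
  obtain ⟨-, hv, ht⟩ := Finset.mem_filter.1 hi
  have hm := memory_eq hy hy' hval (Finset.mem_Ico.1 ht).1 (Finset.mem_Ico.1 ht).2.le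
  simp only [decode]
  rw [hm _ hv, inputSymbol_eq hy hy' ht hv, received_eq hy hy' hval ht hm hv]

/-- A piece of space-time that produces more output bits than enter through its boundary forces
an error when its input symbols are all erased. -/
theorem blockErrorProb_ge_of_piece {ε : ℝ} (h0 : 0 ≤ ε) (h1 : ε ≤ 1)
    (enc : (Fin k → Bool) → (Fin n → Bool)) (S : Finset C.nodes) (t₀ t₁ : ℕ)
    (h : (C.boundaryBits S t₀ t₁).card < (C.outputsIn S t₀ t₁).card) :
    ε ^ (C.inputsIn S t₀ t₁).card / 2 ≤ blockErrorProb ε enc C :=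
  blockErrorProb_ge_of_determined h0 h1 enc C _ _ (C.boundaryBits S t₀ t₁) h
    (fun y b => C.boundaryValue S t₀ y b)
    fun _ _ hy hy' htr _ hi => decode_eq hy hy' (fun b hb => congrFun htr ⟨b, hb⟩) hi

end Circuit
end VLSI

/-! ### Counting over a partition of space-time -/

namespace VLSI
namespace Circuit

variable {s n k : ℕ} (C : Circuit s n k)

/-- Gives inputs a location map of the same shape as `outputAt`, so that `sum_card_pieces` counts
inputs and outputs alike. It is injective because a node receives at most one symbol per cycle. -/
lemma exists_inputsIn_eq : ∃ loc : Fin n → C.nodes × ℕ, Function.Injective loc ∧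
    (∀ i, (loc i).2 < C.cycles) ∧ ∀ S t₀ t₁, C.inputsIn S t₀ t₁ =
      Finset.univ.filter fun i => (loc i).1 ∈ S ∧ (loc i).2 ∈ Finset.Ico t₀ t₁ := by
  choose loc hloc huniq using C.inputAt_once
  refine ⟨loc, fun i j h => ?_, fun i => C.inputAt_lt _ _ i (hloc i), fun S t₀ t₁ => ?_⟩
  · have h1 := hloc i
    have h2 := hloc j
    simp only at h1 h2
    rw [h, h2] at h1
    exact (Option.some.inj h1).symm
  · ext i
    simp only [inputsIn, Finset.mem_filter, Finset.mem_univ, true_and]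
    constructor
    · rintro ⟨v, hv, t, ht, h⟩
      rw [← huniq i (v, t) h]
      exact ⟨hv, ht⟩
    · rintro ⟨hv, ht⟩
      exact ⟨_, hv, _, ht, hloc i⟩

/-- The squares that hold a node or a part of a wire. -/
noncomputable def occupied : Finset (ℤ × ℤ) :=
  C.nodes ∪ Finset.univ.biUnion fun w => (C.route w).support.toFinset

lemma card_occupied : C.occupied.card = C.area := rfl

lemma card_nodes_le_area : C.nodes.card ≤ C.area :=
  Finset.card_le_card Finset.subset_union_left

lemma inputs_le_energy : n ≤ C.energy := by
  obtain ⟨loc, hinj, hlt, -⟩ := C.exists_inputsIn_eq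
  have h := Finset.card_le_card_of_injOn (s := Finset.univ)
    (t := (Finset.univ : Finset C.nodes) ×ˢ Finset.range C.cycles) loc
    (fun i _ => by simpa using hlt i) hinj.injOn
  rw [Finset.card_product, Finset.card_univ, Finset.card_univ, Fintype.card_fin,
    Fintype.card_coe, Finset.card_range] at h
  exact h.trans (Nat.mul_le_mul_right _ C.card_nodes_le_area)

variable {X : Type*} [DecidableEq X] (κ : C.nodes → X)

/-- The nodes with label `p`. -/
def block (p : X) : Finset C.nodes := Finset.univ.filter fun v => κ v = p

/-- The wires whose ends have different labels. -/
def crossWires : Finset (Fin C.numWires) :=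
  Finset.univ.filter fun w => κ (C.tail w) ≠ κ (C.head w)

/-- The indices of the pieces of space-time when time is divided into intervals of length `d`. -/
def pieces (d : ℕ) : Finset (X × ℕ) :=
  Finset.univ.image κ ×ˢ Finset.range (C.cycles / d + 1)

lemma sum_card_pieces {N : ℕ} (loc : Fin N → C.nodes × ℕ) (hlt : ∀ i, (loc i).2 < C.cycles)
    {d : ℕ} (hd : 0 < d) :
    ∑ q ∈ C.pieces κ d, (Finset.univ.filter fun i => (loc i).1 ∈ C.block κ q.1 ∧
      (loc i).2 ∈ Finset.Ico (q.2 * d) (min ((q.2 + 1) * d) C.cycles)).card = N := by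
  have h := Finset.card_eq_sum_card_fiberwise (s := (Finset.univ : Finset (Fin N)))
    (t := C.pieces κ d) (f := fun i => (κ (loc i).1, (loc i).2 / d)) (fun i _ => by
      simp only [pieces, Finset.coe_product, Set.mem_prod, Finset.mem_coe, Finset.mem_range]
      exact ⟨Finset.mem_image_of_mem _ (Finset.mem_univ _),
        Nat.lt_succ_of_le (Nat.div_le_div_right (hlt i).le)⟩)
  rw [Finset.card_univ, Fintype.card_fin] at h
  rw [eq_comm]
  convert h using 3 with q _
  ext i
  have hi := hlt i
  simp only [block, Finset.mem_filter, Finset.mem_univ, true_and, Finset.mem_Ico, lt_min_iff,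
    Prod.ext_iff]
  have h1 := Nat.le_div_iff_mul_le (x := q.2) (y := (loc i).2) hd
  have h2 := Nat.div_lt_iff_lt_mul (x := (loc i).2) (y := q.2 + 1) hd
  grind

lemma sum_min_sub (d T M : ℕ) :
    ∑ m ∈ Finset.range M, (min ((m + 1) * d) T - m * d) = min (M * d) T := by
  induction M with
  | zero => simp
  | succ M ih =>
    rw [Finset.sum_range_succ, ih]
    have : (M + 1) * d = M * d + d := by ring
    omega

lemma sum_card_block : ∑ p ∈ Finset.univ.image κ, (C.block κ p).card = C.nodes.card := by
  rw [← Fintype.card_coe, ← Finset.card_univ]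
  exact (Finset.card_eq_sum_card_image κ _).symm

/-- A wire between different blocks is cut by exactly two of them, those of its tail and of its
head. -/
lemma sum_card_cutWires_le :
    ∑ p ∈ Finset.univ.image κ, (C.cutWires (C.block κ p)).card ≤ 2 * (C.crossWires κ).card := by
  have hfib : ∀ e : Fin C.numWires → C.nodes, (C.crossWires κ).card =
      ∑ p ∈ Finset.univ.image κ, ((C.crossWires κ).filter fun w => κ (e w) = p).card := fun e =>
    Finset.card_eq_sum_card_fiberwise fun w _ => Finset.mem_image_of_mem _ (Finset.mem_univ _)
  have htwo : 2 * (C.crossWires κ).card = ∑ p ∈ Finset.univ.image κ,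
      (((C.crossWires κ).filter fun w => κ (C.tail w) = p).card +
        ((C.crossWires κ).filter fun w => κ (C.head w) = p).card) := by
    rw [Finset.sum_add_distrib, ← hfib, ← hfib, two_mul]
  rw [htwo]
  refine Finset.sum_le_sum fun p _ => ?_
  refine le_trans (Finset.card_le_card fun w hw => ?_) (Finset.card_union_le _ _)
  simp only [cutWires, crossWires, block, Finset.mem_filter, Finset.mem_univ, true_and,
    Finset.mem_union] at hw ⊢
  grind

lemma card_boundaryBits_le (S : Finset C.nodes) (d m t₁ : ℕ) :
    (C.boundaryBits S (m * d) t₁).card ≤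
      (if m = 0 then 0 else S.card * s) + (C.cutWires S).card * (t₁ - m * d) := by
  unfold boundaryBits
  rw [Finset.card_disjSum, Finset.card_product, Nat.card_Ico]
  gcongr
  by_cases hm : m = 0
  · simp [hm]
  · rw [if_neg hm]
    split_ifs <;> simp [Finset.card_product]

/-- Memory is charged at the start of every interval but the first, hence `cycles / d` times
although there are `cycles / d + 1` intervals. Truncating the last interval at `cycles` keeps the
time charged to each cut wire within `cycles`. -/
lemma sum_card_boundaryBits_le (d : ℕ) :
    ∑ q ∈ C.pieces κ d,
      (C.boundaryBits (C.block κ q.1) (q.2 * d) (min ((q.2 + 1) * d) C.cycles)).card ≤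
      C.nodes.card * s * (C.cycles / d) + 2 * (C.crossWires κ).card * C.cycles := by
  refine (Finset.sum_le_sum fun q _ => C.card_boundaryBits_le _ d q.2 _).trans ?_
  rw [Finset.sum_add_distrib]
  unfold pieces
  refine add_le_add (le_of_eq ?_) ?_
  · rw [Finset.sum_product]
    simp only [Finset.sum_range_succ', Nat.add_eq_zero_iff, one_ne_zero, and_false, if_false,
      if_true, add_zero, Finset.sum_const, Finset.card_range, smul_eq_mul]
    rw [← Finset.mul_sum, ← Finset.sum_mul, sum_card_block]
    ring
  · rw [Finset.sum_product]
    simp only [← Finset.mul_sum]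
    rw [← Finset.sum_mul, sum_min_sub]
    exact Nat.mul_le_mul (C.sum_card_cutWires_le κ) (min_le_right _ _)

lemma card_outputsIn_le (S : Finset C.nodes) (t₀ t₁ : ℕ) :
    (C.outputsIn S t₀ t₁).card ≤ S.card * (t₁ - t₀) := by
  rw [← Nat.card_Ico, ← Finset.card_product]
  refine Finset.card_le_card_of_injOn C.outputAt (fun i hi => ?_) C.outputAt_injective.injOn
  simpa [outputsIn] using hi

/-- The number of output bits, when every piece of space-time that produces more bits than enter
through its boundary has at least `l` inputs. -/
theorem outputs_le {d b : ℕ} (hd : 0 < d) (hb : ∀ p, (C.block κ p).card ≤ b) {l : ℝ} (hl : 0 < l)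
    (h : ∀ S t₀ t₁, (C.boundaryBits S t₀ t₁).card < (C.outputsIn S t₀ t₁).card →
      l ≤ (C.inputsIn S t₀ t₁).card) :
    (k : ℝ) ≤ C.nodes.card * s * (C.cycles / d) + 2 * (C.crossWires κ).card * C.cycles +
      b * d / l * n := by
  have hk := C.sum_card_pieces κ C.outputAt C.outputAt_lt hd
  obtain ⟨loc, -, hlt, hin⟩ := C.exists_inputsIn_eq
  have hn := C.sum_card_pieces κ loc hlt hd
  simp only [← hin] at hn
  have hB := C.sum_card_boundaryBits_le κ d
  -- A piece emitting more than its boundary traffic has at least `l` inputs, so its at most `b * d`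
  -- outputs are charged to them at `b * d / l` each.
  have hpiece : ∀ q ∈ C.pieces κ d,
      ((C.outputsIn (C.block κ q.1) (q.2 * d) (min ((q.2 + 1) * d) C.cycles)).card : ℝ) ≤
      (C.boundaryBits (C.block κ q.1) (q.2 * d) (min ((q.2 + 1) * d) C.cycles)).card +
      b * d / l * (C.inputsIn (C.block κ q.1) (q.2 * d) (min ((q.2 + 1) * d) C.cycles)).card := by
    intro q _
    set t₁ := min ((q.2 + 1) * d) C.cycles with ht₁
    have hpos : (0 : ℝ) ≤ b * d / l := by positivity
    by_cases hlarge : (C.boundaryBits (C.block κ q.1) (q.2 * d) t₁).card <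
        (C.outputsIn (C.block κ q.1) (q.2 * d) t₁).card
    · have hlen : t₁ - q.2 * d ≤ d := by
        have : (q.2 + 1) * d = q.2 * d + d := by ring
        omega
      have h1 : (C.outputsIn (C.block κ q.1) (q.2 * d) t₁).card ≤ b * d :=
        (C.card_outputsIn_le _ _ _).trans (Nat.mul_le_mul (hb _) hlen)
      have h2 : ((C.outputsIn (C.block κ q.1) (q.2 * d) t₁).card : ℝ) ≤ b * d := by
        exact_mod_cast h1
      have h3 := mul_le_mul_of_nonneg_left (h _ _ _ hlarge) hpos
      rw [div_mul_cancel₀ _ hl.ne'] at h3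
      have : (0 : ℝ) ≤ (C.boundaryBits (C.block κ q.1) (q.2 * d) t₁).card := Nat.cast_nonneg _
      linarith
    · have h1 : ((C.outputsIn (C.block κ q.1) (q.2 * d) t₁).card : ℝ) ≤
          (C.boundaryBits (C.block κ q.1) (q.2 * d) t₁).card := by
        exact_mod_cast not_lt.1 hlarge
      have := mul_nonneg hpos (Nat.cast_nonneg (C.inputsIn (C.block κ q.1) (q.2 * d) t₁).card)
      linarith
  have hsum := Finset.sum_le_sum hpiece
  rw [Finset.sum_add_distrib, ← Finset.mul_sum] at hsum
  have hk' : ∑ q ∈ C.pieces κ d,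
      ((C.outputsIn (C.block κ q.1) (q.2 * d) (min ((q.2 + 1) * d) C.cycles)).card : ℝ) = k := by
    exact_mod_cast hk
  have hn' : ∑ q ∈ C.pieces κ d,
      ((C.inputsIn (C.block κ q.1) (q.2 * d) (min ((q.2 + 1) * d) C.cycles)).card : ℝ) = n := by
    exact_mod_cast hn
  rw [hk', hn'] at hsum
  have hB' : ∑ q ∈ C.pieces κ d, ((C.boundaryBits (C.block κ q.1) (q.2 * d)
      (min ((q.2 + 1) * d) C.cycles)).card : ℝ) ≤
      C.nodes.card * s * ((C.cycles / d : ℕ) : ℝ) + 2 * (C.crossWires κ).card * C.cycles := by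
    exact_mod_cast hB
  have hdiv : ((C.cycles / d : ℕ) : ℝ) ≤ C.cycles / d := Nat.cast_div_le
  have := mul_le_mul_of_nonneg_left hdiv
    (by positivity : (0 : ℝ) ≤ (C.nodes.card : ℝ) * s)
  linarith

end Circuit
end VLSI

/-! ### Tiling the grid by boxes -/

namespace VLSI

/-- Some translate of the multiples of `d` meets a finite set in at most its `d`-th part. -/
lemma exists_mul_card_dvd_le {α : Type*} (F : Finset α) (c : α → ℤ) {d : ℕ} (hd : 0 < d) :
    ∃ r : ℕ, d * (F.filter fun a => (d : ℤ) ∣ c a + r).card ≤ F.card := by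
  classical
  -- The filtered sets for the `d` offsets are disjoint, so one of them has at most the average
  -- size.
  have hsum : ∑ r ∈ Finset.range d, (F.filter fun a => (d : ℤ) ∣ c a + r).card ≤ F.card := by
    rw [← Finset.card_biUnion]
    · exact Finset.card_le_card (Finset.biUnion_subset.2 fun r _ => Finset.filter_subset _ _)
    · intro r hr r' hr' hne
      rw [Function.onFun, Finset.disjoint_left]
      intro a ha ha'
      have h1 := (Finset.mem_filter.1 ha).2
      have h2 := (Finset.mem_filter.1 ha').2
      have hr := Finset.mem_range.1 hr
      have hr' := Finset.mem_range.1 hr'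
      have h3 : (d : ℤ) ∣ (r : ℤ) - r' := by
        have := dvd_sub h1 h2
        rwa [add_sub_add_left_eq_sub] at this
      apply hne
      have h4 : ((r : ℤ) - r') = 0 := Int.eq_zero_of_abs_lt_dvd h3 (by rw [abs_lt]; omega)
      omega
  by_contra! hcon
  have hlt : ∑ r ∈ Finset.range d, F.card <
      ∑ r ∈ Finset.range d, d * (F.filter fun a => (d : ℤ) ∣ c a + r).card :=
    Finset.sum_lt_sum_of_nonempty (Finset.nonempty_range_iff.2 hd.ne') fun r _ => hcon r
  rw [← Finset.mul_sum, Finset.sum_const, Finset.card_range, smul_eq_mul] at hlt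
  exact absurd hlt (not_lt.2 (Nat.mul_le_mul_left d hsum))

/-- The index of the `d × d` box (of the tiling with offset `(r₁, r₂)`) that holds a square. -/
def box (d r₁ r₂ : ℕ) (x : ℤ × ℤ) : ℤ × ℤ := ((x.1 + r₁) / d, (x.2 + r₂) / d)

lemma dvd_of_ediv_ne {d : ℕ} (hd : 0 < d) {a : ℤ} (h : a / d ≠ (a + 1) / d) :
    (d : ℤ) ∣ a + 1 := by
  by_contra hdvd
  apply h
  have hd' : (0 : ℤ) < d := by exact_mod_cast hd
  have h1 := Int.mul_ediv_add_emod (a + 1) d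
  have h2 : 0 < (a + 1) % d :=
    lt_of_le_of_ne (Int.emod_nonneg _ hd'.ne') fun h0 => hdvd (Int.dvd_of_emod_eq_zero h0.symm)
  have h3 := Int.emod_lt_of_pos (a + 1) hd'
  rw [Int.ediv_eq_iff_of_pos hd']
  constructor <;> nlinarith

lemma grid_adj_cases {x y : ℤ × ℤ} (h : grid.Adj x y) :
    (y.1 = x.1 + 1 ∨ x.1 = y.1 + 1) ∧ x.2 = y.2 ∨ (y.2 = x.2 + 1 ∨ x.2 = y.2 + 1) ∧ x.1 = y.1 := by
  rw [SimpleGraph.boxProd_adj, SimpleGraph.hasse_adj, SimpleGraph.hasse_adj] at h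
  simp only [← Order.succ_eq_iff_covBy, Order.succ_eq_add_one] at h
  grind

/-- A walk between different boxes crosses a vertical or a horizontal side of a box. -/
lemma exists_edge_of_box_ne {d r₁ r₂ : ℕ} (hd : 0 < d) {u v : ℤ × ℤ} (p : grid.Walk u v)
    (h : box d r₁ r₂ u ≠ box d r₁ r₂ v) :
    (∃ x ∈ p.support, (d : ℤ) ∣ (x.1 + 1) + r₁ ∧ s(x, (x.1 + 1, x.2)) ∈ p.edges) ∨
    (∃ x ∈ p.support, (d : ℤ) ∣ (x.2 + 1) + r₂ ∧ s(x, (x.1, x.2 + 1)) ∈ p.edges) := by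
  obtain ⟨e, he, h1, h2⟩ := p.exists_boundary_dart {x | box d r₁ r₂ x = box d r₁ r₂ u} rfl
    (fun h' => h h'.symm)
  have hne : box d r₁ r₂ e.fst ≠ box d r₁ r₂ e.snd := fun h' => h2 (h'.symm.trans h1)
  have hfst := p.dart_fst_mem_support_of_mem_darts he
  have hsnd := p.dart_snd_mem_support_of_mem_darts he
  have hedge : s(e.fst, e.snd) ∈ p.edges := List.mem_map_of_mem he
  have hadj := e.adj
  obtain ⟨⟨⟨x₁, x₂⟩, ⟨y₁, y₂⟩⟩, _⟩ := e
  simp only [box, ne_eq, Prod.mk.injEq, not_and_or] at hne hfst hsnd hedge hadj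
  have key : ∀ (a : ℤ) (r : ℕ), ¬ (a + r) / (d : ℤ) = (a + 1 + r) / d → (d : ℤ) ∣ (a + 1) + r := by
    intro a r hr
    have h3 : a + 1 + r = a + r + 1 := by ring
    rw [h3] at hr ⊢
    exact dvd_of_ediv_ne hd hr
  -- The crossed side is named by its left or lower square, in whichever direction the walk crosses
  -- it.
  rcases grid_adj_cases hadj with ⟨h3 | h3, h4⟩ | ⟨h3 | h3, h4⟩ <;> simp only at h3 h4 <;> subst h3 h4
  · exact .inl ⟨_, hfst, key _ _ (by simpa using hne), hedge⟩
  · exact .inl ⟨_, hsnd, key _ _ (by simpa [eq_comm] using hne), by rwa [Sym2.eq_swap]⟩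
  · exact .inr ⟨_, hfst, key _ _ (by simpa using hne), hedge⟩
  · exact .inr ⟨_, hsnd, key _ _ (by simpa [eq_comm] using hne), by rwa [Sym2.eq_swap]⟩

namespace Circuit

variable {s n k : ℕ} (C : Circuit s n k)

lemma mem_occupied_of_mem_support {w : Fin C.numWires} {x : ℤ × ℤ}
    (hx : x ∈ (C.route w).support) : x ∈ C.occupied :=
  Finset.mem_union_right _
    (Finset.mem_biUnion.2 ⟨w, Finset.mem_univ _, List.mem_toFinset.2 hx⟩)

lemma eq_of_mem_edges {w w' : Fin C.numWires} {e : Sym2 (ℤ × ℤ)}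
    (h : e ∈ (C.route w).edges) (h' : e ∈ (C.route w').edges) : w = w' := by
  by_contra hne
  exact C.route_disjoint w w' hne h h'

/-- Each crossing wire is assigned a side on a box border that it crosses. Wires share no sides, so
the square and direction naming that side determine the wire. -/
lemma card_crossWires_box_le {d : ℕ} (hd : 0 < d) (r₁ r₂ : ℕ) :
    (C.crossWires fun v => box d r₁ r₂ v).card ≤
      (C.occupied.filter fun x => (d : ℤ) ∣ (x.1 + 1) + r₁).card +
      (C.occupied.filter fun x => (d : ℤ) ∣ (x.2 + 1) + r₂).card := by
  rw [← Finset.card_disjSum]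
  refine Finset.card_le_card_of_forall_subsingleton
    (fun w q => Sum.elim (fun x => s(x, (x.1 + 1, x.2))) (fun x => s(x, (x.1, x.2 + 1))) q ∈
      (C.route w).edges) (fun w hw => ?_) (fun q _ w hw w' hw' => C.eq_of_mem_edges hw.2 hw'.2)
  rcases exists_edge_of_box_ne hd (C.route w) (Finset.mem_filter.1 hw).2 with
    ⟨x, hx, hdvd, he⟩ | ⟨x, hx, hdvd, he⟩
  · exact ⟨.inl x, by simp [C.mem_occupied_of_mem_support hx, hdvd], he⟩
  · exact ⟨.inr x, by simp [C.mem_occupied_of_mem_support hx, hdvd], he⟩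

lemma card_block_box_le {d : ℕ} (hd : 0 < d) (r₁ r₂ : ℕ) (p : ℤ × ℤ) :
    (C.block (fun v => box d r₁ r₂ v) p).card ≤ d ^ 2 := by
  have hd' : (0 : ℤ) < d := by exact_mod_cast hd
  have hcard : (Finset.Ico (p.1 * d - r₁) (p.1 * d - r₁ + d) ×ˢ
      Finset.Ico (p.2 * d - r₂) (p.2 * d - r₂ + d)).card = d ^ 2 := by
    simp [Finset.card_product, sq]
  rw [← hcard]
  refine Finset.card_le_card_of_injOn Subtype.val (fun v hv => ?_) Subtype.val_injective.injOn
  have hv := (Finset.mem_filter.1 hv).2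
  simp only [box, Prod.ext_iff, Int.ediv_eq_iff_of_pos hd'] at hv
  simp only [Finset.coe_product, Set.mem_prod, Finset.mem_coe, Finset.mem_Ico]
  constructor <;> constructor <;> linarith

/-- A tradeoff between area, time and the number `l` of inputs of the pieces of space-time that
produce more bits than enter through their boundary. -/
theorem outputs_le_of_box {d : ℕ} (hd : 0 < d) {l : ℝ} (hl : 0 < l)
    (h : ∀ S t₀ t₁, (C.boundaryBits S t₀ t₁).card < (C.outputsIn S t₀ t₁).card →
      l ≤ (C.inputsIn S t₀ t₁).card) :
    (k : ℝ) ≤ (s + 4) * C.energy / d + d ^ 3 / l * n := by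
  obtain ⟨r₁, h1⟩ := exists_mul_card_dvd_le C.occupied (fun x => x.1 + 1) hd
  obtain ⟨r₂, h2⟩ := exists_mul_card_dvd_le C.occupied (fun x => x.2 + 1) hd
  have hcross := C.card_crossWires_box_le hd r₁ r₂
  have hmul : d * (C.crossWires fun v => box d r₁ r₂ v).card ≤ 2 * C.area := by
    rw [← card_occupied]
    nlinarith
  have hmul' : (d : ℝ) * (C.crossWires fun v => box d r₁ r₂ v).card ≤ 2 * C.area := by
    exact_mod_cast hmul
  have hnodes : (C.nodes.card : ℝ) ≤ C.area := by exact_mod_cast C.card_nodes_le_area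
  have hd' : (0 : ℝ) < d := by exact_mod_cast hd
  have hmain := C.outputs_le (fun v => box d r₁ r₂ v) hd (C.card_block_box_le hd r₁ r₂) hl h
  have hen : (C.energy : ℝ) = C.area * C.cycles := by simp [energy]
  have hcross' : ((C.crossWires fun v => box d r₁ r₂ v).card : ℝ) ≤ 2 * C.area / d := by
    rw [le_div_iff₀ hd']; linarith
  calc (k : ℝ) ≤ _ := hmain
    -- In the resulting `s + 4`, the `4` is two blocks per cut wire times two directions of box
    -- sides.
    _ ≤ C.area * s * (C.cycles / d) + 2 * (2 * C.area / d) * C.cycles +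
        ((d ^ 2 : ℕ) : ℝ) * d / l * n := by gcongr
    _ = _ := by rw [hen]; push_cast; ring

/-! ### From the tradeoff to the energy bound -/

/-- A lower bound on the number of inputs of a piece that forces an error. -/
lemma le_card_inputsIn {ε : ℝ} (hε0 : 0 < ε) (hε1 : ε < 1)
    (enc : (Fin k → Bool) → (Fin n → Bool)) {q : ℝ} (hq : blockErrorProb ε enc C < q)
    (S : Finset C.nodes) (t₀ t₁ : ℕ)
    (h : (C.boundaryBits S t₀ t₁).card < (C.outputsIn S t₀ t₁).card) :
    (-Real.log q - Real.log 2) / -Real.log ε ≤ (C.inputsIn S t₀ t₁).card := by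
  have hlog : 0 < -Real.log ε := neg_pos.2 (Real.log_neg hε0 hε1)
  have h1 := (blockErrorProb_ge_of_piece hε0.le hε1.le enc S t₀ t₁ h).trans_lt hq
  have h2 := Real.log_le_log (by positivity) h1.le
  rw [Real.log_div (by positivity) (by norm_num), Real.log_pow] at h2
  rw [div_le_iff₀ hlog]
  linarith

/-- The energy per input of a decoder is at least of the order of the cube root of the negative
logarithm of its error probability. -/
theorem neg_log_le_cube {ε : ℝ} (hε0 : 0 < ε) (hε1 : ε < 1)
    (enc : (Fin k → Bool) → (Fin n → Bool)) {q ρ : ℝ} (hq : blockErrorProb ε enc C < q)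
    (hρ : 0 < ρ) (hn : 0 < n) (hk : ρ * n ≤ k) :
    -Real.log q ≤ (2 * Real.log 2 + 4 * -Real.log ε * (2 * (s + 4) / ρ + 1) ^ 3 / ρ) *
      ((C.energy : ℝ) / n) ^ 3 := by
  have hlog : 0 < -Real.log ε := neg_pos.2 (Real.log_neg hε0 hε1)
  have hlog2 : 0 < Real.log 2 := Real.log_pos (by norm_num)
  have hn' : (0 : ℝ) < n := by exact_mod_cast hn
  set a : ℝ := (C.energy : ℝ) / n with ha
  have ha1 : 1 ≤ a := by
    rw [ha, le_div_iff₀ hn', one_mul]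
    exact_mod_cast C.inputs_le_energy
  have hE : (C.energy : ℝ) = a * n := by rw [ha, div_mul_cancel₀ _ hn'.ne']
  have ha3 : 1 ≤ a ^ 3 := one_le_pow₀ ha1
  set c : ℝ := 2 * (s + 4) / ρ with hc
  have hc0 : 0 < c := by positivity
  -- For small `-log q` the term `2 * log 2` suffices, since `a ≥ 1`. Otherwise `l` is positive, and
  -- subtracting `log 2` costs at most half of `-log q`.
  by_cases hsmall : -Real.log q ≤ 2 * Real.log 2
  · have : 0 ≤ 4 * -Real.log ε * (c + 1) ^ 3 / ρ * a ^ 3 := by positivity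
    nlinarith
  · push Not at hsmall
    set l : ℝ := (-Real.log q - Real.log 2) / -Real.log ε with hl
    have hl0 : 0 < l := div_pos (by linarith) hlog
    -- With `c = 2 * (s + 4) / ρ` the boundary term is at most `ρ * n / 2`; rounding up only turns
    -- `c` into `c + 1`, because `a ≥ 1`.
    set d : ℕ := ⌈c * a⌉₊ with hd
    have hca : 0 < c * a := by positivity
    have hd0 : 0 < d := Nat.ceil_pos.2 hca
    have hd0' : (0 : ℝ) < d := by exact_mod_cast hd0
    have hdle : c * a ≤ d := Nat.le_ceil _
    have hdlt : (d : ℝ) ≤ (c + 1) * a := by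
      have := (Nat.ceil_lt_add_one hca.le).le
      linarith
    have hmain := C.outputs_le_of_box hd0 hl0 (C.le_card_inputsIn hε0 hε1 enc hq)
    have hfirst : (s + 4) * (C.energy : ℝ) / d ≤ ρ * n / 2 := by
      rw [div_le_iff₀ hd0', hE]
      calc ((s : ℝ) + 4) * (a * n) = ρ * n / 2 * (c * a) := by
            rw [hc]; field_simp
        _ ≤ ρ * n / 2 * d := by gcongr
    have hsecond : ρ / 2 * n ≤ d ^ 3 / l * n := by linarith
    have hthird : ρ / 2 ≤ d ^ 3 / l := le_of_mul_le_mul_right hsecond hn'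
    rw [le_div_iff₀ hl0] at hthird
    have hd3 : (d : ℝ) ^ 3 ≤ (c + 1) ^ 3 * a ^ 3 := by
      rw [← mul_pow]; gcongr
    have hl2 : -Real.log q / 2 ≤ l * -Real.log ε := by
      rw [hl, div_mul_cancel₀ _ hlog.ne']; linarith
    have hl3 : l ≤ 2 / ρ * ((c + 1) ^ 3 * a ^ 3) := by
      have : l = 2 / ρ * (ρ / 2 * l) := by field_simp
      rw [this]
      exact mul_le_mul_of_nonneg_left (hthird.trans hd3) (by positivity)
    calc -Real.log q ≤ 2 * (l * -Real.log ε) := by linarith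
      _ ≤ 2 * (2 / ρ * ((c + 1) ^ 3 * a ^ 3) * -Real.log ε) := by gcongr
      _ = 0 + 4 * -Real.log ε * (c + 1) ^ 3 / ρ * a ^ 3 := by ring
      _ ≤ 2 * Real.log 2 * a ^ 3 + 4 * -Real.log ε * (c + 1) ^ 3 / ρ * a ^ 3 := by
          gcongr; positivity
      _ = _ := by ring

end Circuit
end VLSI

/-- The exponent `1 / 3` of `VLSI.Circuit.neg_log_le_cube`, which holds without regularity of the
outputs, implies the exponent `1 / 5`, as the energy per input is at least `1`. -/
theorem mainTheorem7 (s : ℕ) (ε : ℝ) (hε0 : 0 < ε) (hε1 : ε < 1)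
    (f : ℕ → ℝ) (hf : ∀ᶠ n in atTop, f n ≤ 1)
    (D : VLSI.DecodingScheme s) (R : ℝ) (hR : 0 < R) (hrate : D.HasRate R)
    (hD : D.IsErrorScheme ε f)
    (hreg : D.OutputRegular) (hout : D.IncreasingOutputNodes) :
    ∃ c : ℝ, 0 < c ∧ ∀ᶠ i in atTop,
      c * ((D.n i : ℝ) * (-Real.log (f (D.n i))) ^ (1 / 5 : ℝ)) ≤ ((D.circuit i).energy : ℝ) := by
  set M : ℝ := 2 * Real.log 2 + 4 * -Real.log ε * (2 * (s + 4) / (R / 2) + 1) ^ 3 / (R / 2)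
    with hM
  have hlog : 0 < -Real.log ε := neg_pos.2 (Real.log_neg hε0 hε1)
  have hlog2 : 0 < Real.log 2 := Real.log_pos (by norm_num)
  have hM0 : 0 < M := by positivity
  refine ⟨(M ^ (1 / 5 : ℝ))⁻¹, by positivity, ?_⟩
  have hntop := D.n_strictMono.tendsto_atTop
  filter_upwards [hD, hntop.eventually hf, hntop.eventually (eventually_gt_atTop 0),
    hrate.eventually (lt_mem_nhds (half_lt_self hR))] with i hi hfi hni hki
  have hn' : (0 : ℝ) < D.n i := by exact_mod_cast hni
  have hk : R / 2 * D.n i ≤ D.k i := ((lt_div_iff₀ hn').1 hki).le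
  have hpos : 0 < f (D.n i) :=
    (VLSI.blockErrorProb_nonneg hε0.le hε1.le (D.enc i) (D.circuit i)).trans_lt hi
  have hL : 0 ≤ -Real.log (f (D.n i)) := neg_nonneg.2 (Real.log_nonpos hpos.le hfi)
  have hbound := (D.circuit i).neg_log_le_cube hε0 hε1 (D.enc i) hi (half_pos hR) hni hk
  rw [← hM] at hbound
  set a : ℝ := ((D.circuit i).energy : ℝ) / D.n i with ha
  have ha1 : 1 ≤ a := by
    rw [ha, le_div_iff₀ hn', one_mul]
    exact_mod_cast (D.circuit i).inputs_le_energy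
  have hE : ((D.circuit i).energy : ℝ) = D.n i * a := by rw [ha, mul_div_cancel₀ _ hn'.ne']
  have h5 : -Real.log (f (D.n i)) ≤ M * a ^ 5 :=
    hbound.trans (by gcongr; norm_num)
  have hroot : (-Real.log (f (D.n i))) ^ (1 / 5 : ℝ) ≤ M ^ (1 / 5 : ℝ) * a := by
    refine (Real.rpow_le_rpow hL h5 (by norm_num)).trans (le_of_eq ?_)
    rw [Real.mul_rpow hM0.le (by positivity), ← Real.rpow_natCast, ← Real.rpow_mul (by positivity)]
    norm_num
  rw [hE]
  calc (M ^ (1 / 5 : ℝ))⁻¹ * ((D.n i : ℝ) * (-Real.log (f (D.n i))) ^ (1 / 5 : ℝ))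
      ≤ (M ^ (1 / 5 : ℝ))⁻¹ * ((D.n i : ℝ) * (M ^ (1 / 5 : ℝ) * a)) := by gcongr
    _ = D.n i * a := by
        have : M ^ (1 / 5 : ℝ) ≠ 0 := by positivity
        field_simp
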